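/- Let $P$ be a regular pentagon with right angles in the hyperbolic plane, and let the \emph{pentagrid} be the tessellation $\{5,4\}$ generated by $P$: $P$ is a tile, and the reflection of a tile in a line supporting a side of a tile is a tile. Its graph has as vertices the vertices of the tiles and as edges the sides of the tiles. Let $G$ be a group of isometries of the hyperbolic plane that leaves the pentagrid globally invariant, i.e. every element of $G$ maps each tile onto a tile. Then the pentagrid is not the Cayley graph of $G$, in either of the following senses. (1) Let $A$ be any set of arcs obtained by giving each edge of the pentagrid one of its two directions, or both, and let $V$ be the set of vertices. Then there is no finite set $S$ of generators of $G$ such that, when an arc from $v$ to $w$ is labelled by those $\gamma\in S\cup S^{-1}$ with $\gamma(v)=w$: every arc has at least one label; for each $v\in V$, the set of labels of the arcs starting from $v$ or arriving at $v$ generates $G$; and this set is the same for all $v\in V$. (2) There is no finite set $S$ of generators of $G$ such that the graph of the pentagrid is isomorphic, as an abstract undirected graph, to the usual Cayley graph of $G$ with respect to $S$, whose vertices are the elements of $G$ and whose edges join $g$ to $gs$ for $g\in G$, $s\in S\setminus\{1\}$. -/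

import Mathlib

open UpperHalfPlane

noncomputable section

/-- The angle at `B` of the hyperbolic triangle `A B C`, for `A ≠ B ≠ C`, by the hyperbolic law of
cosines. -/
def hypAngle (A B C : ℍ) : ℝ :=
  Real.arccos
    ((Real.cosh (dist A B) * Real.cosh (dist B C) - Real.cosh (dist A C)) /
      (Real.sinh (dist A B) * Real.sinh (dist B C)))

/-- `P 0, …, P 4` are, in cyclic order, the vertices of a regular hyperbolic pentagon with right
angles. By the hyperbolic Pythagorean theorem, equal sides and right angles determine all the ten
mutual distances of the vertices, so that such a pentagon is unique up to an isometry. -/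
structure IsRegularRightPentagon (P : Fin 5 → ℍ) : Prop where
  injective : Function.Injective P
  side_eq : ∀ i, dist (P i) (P (i + 1)) = dist (P 0) (P 1)
  angle_eq : ∀ i, hypAngle (P i) (P (i + 1)) (P (i + 2)) = Real.pi / 2

/-- For `A ≠ B`: `σ` is the reflection in the hyperbolic line through `A` and `B`, that is, the only
isometry other than the identity that fixes both points. -/
def IsReflectionInLine (A B : ℍ) (σ : ℍ ≃ᵢ ℍ) : Prop :=
  σ ≠ 1 ∧ σ A = A ∧ σ B = B

/-- The tiles of the tessellation generated by the pentagon `P`, each given by its vertices in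
cyclic order: `P` is a tile, and the reflection of a tile in the line supporting a side of a tile
is a tile. When `P` is a regular pentagon with right angles, this is the pentagrid `{5,4}`. -/
inductive IsTile (P : Fin 5 → ℍ) : (Fin 5 → ℍ) → Prop
  | base : IsTile P P
  | reflect (Q R : Fin 5 → ℍ) (i : Fin 5) (σ : ℍ ≃ᵢ ℍ) :
      IsTile P Q → IsTile P R → IsReflectionInLine (R i) (R (i + 1)) σ →
        IsTile P (fun j => σ (Q j))

/-- The vertices of the tessellation generated by `P`. -/
def gridVertices (P : Fin 5 → ℍ) : Set ℍ :=
  {z | ∃ Q, IsTile P Q ∧ z ∈ Set.range Q}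

/-- The graph of the tessellation generated by `P`: its vertices are the vertices of the tiles and
its edges are the sides of the tiles. -/
def gridGraph (P : Fin 5 → ℍ) : SimpleGraph (gridVertices P) where
  Adj v w := v ≠ w ∧ ∃ Q, IsTile P Q ∧ ∃ i,
    ((v : ℍ) = Q i ∧ (w : ℍ) = Q (i + 1)) ∨ ((w : ℍ) = Q i ∧ (v : ℍ) = Q (i + 1))
  symm := ⟨fun _ _ ⟨hne, Q, hQ, i, h⟩ => ⟨hne.symm, Q, hQ, i, h.symm⟩⟩
  loopless := ⟨fun _ h => h.1 rfl⟩

/-- The group `G` of isometries leaves the tessellation generated by `P` globally invariant: each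
of its elements maps every tile onto a tile (a tile being determined by its set of vertices). As `G`
contains inverses, each element then permutes the tiles. -/
def LeavesGridInvariant (P : Fin 5 → ℍ) (G : Subgroup (ℍ ≃ᵢ ℍ)) : Prop :=
  ∀ g ∈ G, ∀ Q, IsTile P Q → ∃ R, IsTile P R ∧ g '' Set.range Q = Set.range R

/-- `(V, A)` is a directed graph whose underlying undirected graph is `Γ`: every edge of `Γ` carries
an arc in at least one of the two directions, and there are no other arcs. -/
def IsDirectedVersion {V : Type*} (Γ : SimpleGraph V) (A : V → V → Prop) : Prop :=
  ∀ v w, (A v w ∨ A w v) ↔ Γ.Adj v w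

/-- The labels around `v`: the elements `γ` of `L` that label an arc starting from `v` or arriving
at `v`, where `γ` labels an arc from `a` to `b` if and only if `γ a = b`. -/
def labelsAround {V : Set ℍ} (A : V → V → Prop) (L : Set (ℍ ≃ᵢ ℍ)) (v : V) : Set (ℍ ≃ᵢ ℍ) :=
  {γ | γ ∈ L ∧ ∃ w : V, (A v w ∧ γ (v : ℍ) = w) ∨ (A w v ∧ γ (w : ℍ) = v)}

/-- The directed graph `(V, A)`, with `V` a set of points of the hyperbolic plane, is the Cayley
graph of the group `G` of isometries in the geometric sense: `G` has a finite set `S` of generators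
such that, an arc from `v` to `w` being labelled by those `γ ∈ S ∪ S⁻¹` for which `γ v = w`,
every arc has a label, the labels around each vertex generate `G`, and the set of labels around
a vertex is the same for all the vertices. -/
def IsGeometricCayleyGraph {V : Set ℍ} (A : V → V → Prop) (G : Subgroup (ℍ ≃ᵢ ℍ)) : Prop :=
  ∃ S : Set (ℍ ≃ᵢ ℍ), S.Finite ∧ Subgroup.closure S = G ∧
    (∀ v w : V, A v w → ∃ γ ∈ S ∪ S⁻¹, γ (v : ℍ) = w) ∧
    (∀ v : V, Subgroup.closure (labelsAround A (S ∪ S⁻¹) v) = G) ∧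
    (∀ v w : V, labelsAround A (S ∪ S⁻¹) v = labelsAround A (S ∪ S⁻¹) w)

/-- The graph `Γ` is a Cayley graph of the group `G` in the usual sense: it is isomorphic to the
graph on the elements of `G` whose edges join `g` to `g * s`, for `g` in `G` and `s ≠ 1` in
some finite generating set `S` of `G`. -/
def IsCayleyGraph {V : Type*} (Γ : SimpleGraph V) (G : Type*) [Group G] : Prop :=
  ∃ S : Set G, S.Finite ∧ Subgroup.closure S = ⊤ ∧ Nonempty (SimpleGraph.mulCayley S ≃g Γ)

end

/-!
The hyperbolic cosine of the side of the regular right-angled pentagon is the golden ratio `φ`. In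
the hyperboloid model, scaled coordinates adapted to a right angle of the pentagon turn the form
into `t ^ 2 - φ * (a ^ 2 + b ^ 2)`, and the vertices of all the tiles have coordinates in `ℤ[φ]`
(`IsRegularRightPentagon.isGoldenPoint_of_mem`), because a reflection in a side of a tile preserves
the points with coordinates in `ℤ[φ]`, and these points are the same for all the tiles.

This determines the tessellation around a vertex without a theory of tessellations: the points with
coordinates in `ℤ[φ]` at the distance of a side from a vertex are given by the equation
`a ^ 2 + b ^ 2 = 1`, which has only the solutions `(±1, 0)`, `(0, ±1)` in `ℤ[φ]`. Two steps of this
kind show that the graph has no quadrilaterals (`IsRegularRightPentagon.eq_of_common_neighbors`) and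
at most four pentagons through a vertex (`encard_pentagons_lt`).

Geometric sense: a label of an arc occurs around every vertex, hence moves every vertex to a
neighbour. As there are no quadrilaterals and a vertex has more than two neighbours, no isometry
preserving the vertices does so (`exists_cosh_dist_ne`).

Abstract sense: in a Cayley graph of `G`, the pentagons form a left-invariant family of sets of five
elements of `G`. The five translates of a pentagon `F` by the inverses of its elements contain `1`,
so that two of them coincide, and the stabilizer of `F` is a group of order five acting simply
transitively on `F`. If two tiles `E` and `F` share just a side `{x, y}`, the translation by
`y * x⁻¹` stabilizes both, hence exchanges `x` and `y`, which is impossible in a group of order five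
(`inter_ne_pair_of_encard_lt`).
-/

noncomputable section

open UpperHalfPlane
open Real (goldenRatio)
open scoped goldenRatio

/-! ### Invariant families of subsets of a group -/

open Pointwise in
theorem stabilizer_mul_self {G : Type*} [Group G] (F : Set G) :
    F⁻¹ * (MulAction.stabilizer G F : Set G) = F⁻¹ := by
  ext x
  constructor
  · rintro ⟨a, ha, b, hb, rfl⟩
    have hb' : b⁻¹ ∈ MulAction.stabilizer G F := inv_mem hb
    rw [MulAction.mem_stabilizer_iff] at hb'
    rw [Set.mem_inv] at ha ⊢
    rw [← hb']
    exact ⟨a⁻¹, ha, by simp⟩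
  · intro hx
    exact ⟨x, hx, 1, one_mem _, by simp⟩

open Pointwise in
theorem card_stabilizer_dvd {G : Type*} [Group G] (F : Set G) :
    Nat.card (MulAction.stabilizer G F) ∣ F.ncard := by
  have h := Subgroup.card_mul_eq_card_subgroup_mul_card_quotient (MulAction.stabilizer G F) F⁻¹
  rw [stabilizer_mul_self] at h
  have h2 : Nat.card (F⁻¹ : Set G) = F.ncard := by
    rw [Nat.card_coe_set_eq, ← Set.image_inv_eq_inv, Set.ncard_image_of_injective _ inv_injective]
  exact ⟨_, h2 ▸ h⟩

open Pointwise in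
/-- Let `𝓕` be a left-invariant family of sets of prime cardinality `p` in a group, fewer than `p` of
which contain `1`. By the pigeonhole principle, two of the translates `x⁻¹ • F`, for `x ∈ F`,
coincide, so that `F ∈ 𝓕` has a nontrivial stabilizer; as `F` is a union of right cosets of its
stabilizer, it is a single one. -/
theorem mul_inv_mem_stabilizer_of_encard_lt {G : Type*} [Group G] (𝓕 : Set (Set G)) {p : ℕ}
    (hp : p.Prime) (hinv : ∀ (g : G), ∀ F ∈ 𝓕, g • F ∈ 𝓕) (hcard : ∀ F ∈ 𝓕, F.ncard = p)
    (hone : {F ∈ 𝓕 | (1 : G) ∈ F}.encard < p) {F : Set G} (hF : F ∈ 𝓕) :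
    Nat.card (MulAction.stabilizer G F) = p ∧
      ∀ x ∈ F, ∀ y ∈ F, y * x⁻¹ ∈ MulAction.stabilizer G F := by
  have hfin : F.Finite := Set.finite_of_ncard_ne_zero (by rw [hcard F hF]; exact hp.ne_zero)
  have hFe : F.encard = p := by rw [← hfin.cast_ncard_eq, hcard F hF]
  obtain ⟨a, ha, b, hb, hab, he⟩ := Set.exists_ne_map_eq_of_encard_lt_of_maps_to
    (s := F) (t := {F ∈ 𝓕 | (1 : G) ∈ F}) (f := fun x => x⁻¹ • F) (by rw [hFe]; exact hone)
    (fun x hx => ⟨hinv _ _ hF, x, hx, by simp⟩)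
  have hg : a * b⁻¹ ∈ MulAction.stabilizer G F := by
    rw [MulAction.mem_stabilizer_iff, mul_smul]
    exact (congrArg (a • ·) he.symm).trans (by simp)
  have hc : Nat.card (MulAction.stabilizer G F) = p := by
    have hd := card_stabilizer_dvd F
    rw [hcard F hF] at hd
    refine (hp.eq_one_or_self_of_dvd _ hd).resolve_left fun h1 => hab ?_
    rw [Subgroup.card_eq_one] at h1
    rw [h1, Subgroup.mem_bot, mul_inv_eq_one] at hg
    exact hg
  refine ⟨hc, fun x hx y hy => ?_⟩
  have hsub : (· * x) '' (MulAction.stabilizer G F : Set G) ⊆ F := by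
    rintro _ ⟨h, hh, rfl⟩
    have hh' := MulAction.mem_stabilizer_iff.1 hh
    rw [← hh']
    exact ⟨x, hx, rfl⟩
  have heq := Set.eq_of_subset_of_ncard_le hsub (by
    rw [Set.ncard_image_of_injective _ (mul_left_injective x), hcard F hF, ← hc]; rfl) hfin
  rw [← heq] at hy
  obtain ⟨h, hh, rfl⟩ := hy
  simpa using hh

open Pointwise in
/-- Two members of such a family, for `p` odd, cannot meet in exactly two elements `x` and `y`:
`y * x⁻¹` would stabilize both, hence exchange `x` and `y`, and would be an involution in a group
of odd order. -/
theorem inter_ne_pair_of_encard_lt {G : Type*} [Group G] (𝓕 : Set (Set G)) {p : ℕ}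
    (hp : p.Prime) (hp2 : Odd p) (hinv : ∀ (g : G), ∀ F ∈ 𝓕, g • F ∈ 𝓕)
    (hcard : ∀ F ∈ 𝓕, F.ncard = p) (hone : {F ∈ 𝓕 | (1 : G) ∈ F}.encard < p)
    {E F : Set G} (hE : E ∈ 𝓕) (hF : F ∈ 𝓕) {x y : G} (hxy : x ≠ y) : E ∩ F ≠ {x, y} := by
  intro h
  have hx : x ∈ E ∩ F := by simp [h]
  have hy : y ∈ E ∩ F := by simp [h]
  obtain ⟨-, hE'⟩ := mul_inv_mem_stabilizer_of_encard_lt 𝓕 hp hinv hcard hone hE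
  obtain ⟨hc, hF'⟩ := mul_inv_mem_stabilizer_of_encard_lt 𝓕 hp hinv hcard hone hF
  have h1 := hE' x hx.1 y hy.1
  have h2 := hF' x hx.2 y hy.2
  have hr : y * x⁻¹ ≠ 1 := fun h => hxy (mul_inv_eq_one.1 h).symm
  have hry : (y * x⁻¹) * y ∈ E ∩ F := by
    constructor
    · exact (MulAction.mem_stabilizer_iff.1 h1).subset ⟨y, hy.1, rfl⟩
    · exact (MulAction.mem_stabilizer_iff.1 h2).subset ⟨y, hy.2, rfl⟩
  rw [h] at hry
  rcases hry with hry | hry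
  · have hsq : (y * x⁻¹) ^ 2 = 1 := by
      rw [pow_two, ← mul_assoc, hry, mul_inv_cancel]
    have ho : orderOf (y * x⁻¹) ∣ p := by
      have := Subgroup.orderOf_dvd_natCard _ h2
      rwa [hc] at this
    have hd : orderOf (y * x⁻¹) ∣ Nat.gcd 2 p := Nat.dvd_gcd (orderOf_dvd_of_pow_eq_one hsq) ho
    rw [Nat.Coprime.gcd_eq_one (Nat.coprime_two_left.2 hp2), Nat.dvd_one, orderOf_eq_one_iff] at hd
    exact hr hd
  · exact hr (mul_eq_right.1 hry)

/-! ### Reflections of the hyperbolic plane -/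

theorem dist_eq_of_cosh_dist_eq {X Y : Type*} [PseudoMetricSpace X] [PseudoMetricSpace Y]
    {a b : X} {c d : Y} (h : Real.cosh (dist a b) = Real.cosh (dist c d)) : dist a b = dist c d :=
  Real.cosh_injOn dist_nonneg dist_nonneg h

theorem exists_isReflectionInLine (A B : ℍ) : ∃ σ, IsReflectionInLine A B σ := by
  have key : ∀ f : ℍ → ℍ, (∀ z, f (f z) = z) →
      (∀ z w, Real.cosh (dist (f z) (f w)) = Real.cosh (dist z w)) → f A = A → f B = B →
      (∃ z, f z ≠ z) → ∃ σ, IsReflectionInLine A B σ := by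
    intro f hinv hcosh hA hB ⟨z, hz⟩
    exact ⟨⟨⟨f, f, hinv, hinv⟩, Isometry.of_dist_eq fun z w => dist_eq_of_cosh_dist_eq (hcosh z w)⟩,
      fun h => hz (DFunLike.congr_fun h z), hA, hB⟩
  by_cases hre : A.re = B.re
  · -- The line is the vertical half-line above `A.re`.
    refine key (fun z => ⟨⟨2 * A.re - z.re, z.im⟩, z.im_pos⟩) ?_ ?_ ?_ ?_
      ⟨⟨⟨A.re + 1, 1⟩, one_pos⟩, ?_⟩
    · intro z
      apply UpperHalfPlane.ext_re_im
      · simp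
      · simp
    · intro z w
      simp only [cosh_dist', UpperHalfPlane.re, UpperHalfPlane.im]
      ring
    · apply UpperHalfPlane.ext_re_im
      · simp [two_mul]
      · simp
    · apply UpperHalfPlane.ext_re_im
      · simp [two_mul, hre]
      · simp
    · intro h
      have := congrArg UpperHalfPlane.re h
      simp at this
      linarith
  · -- The line is a half-circle centred at the real point `c` equidistant from `A` and `B`.
    have hre' : A.re - B.re ≠ 0 := sub_ne_zero.2 hre
    obtain ⟨c, hc⟩ : ∃ c : ℝ, (A.re - c) ^ 2 + A.im ^ 2 = (B.re - c) ^ 2 + B.im ^ 2 := by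
      refine ⟨(A.re ^ 2 + A.im ^ 2 - B.re ^ 2 - B.im ^ 2) / (2 * (A.re - B.re)), ?_⟩
      field_simp
      ring
    obtain ⟨s, hs⟩ : ∃ s, s = (A.re - c) ^ 2 + A.im ^ 2 := ⟨_, rfl⟩
    have hs0 : 0 < s := by rw [hs]; have := A.im_pos; positivity
    have hD : ∀ z : ℍ, 0 < (z.re - c) ^ 2 + z.im ^ 2 := fun z => by have := z.im_pos; positivity
    let f : ℍ → ℍ := fun z => ⟨⟨c + s * (z.re - c) / ((z.re - c) ^ 2 + z.im ^ 2),
      s * z.im / ((z.re - c) ^ 2 + z.im ^ 2)⟩, div_pos (mul_pos hs0 z.im_pos) (hD z)⟩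
    have fre : ∀ z, (f z).re = c + s * (z.re - c) / ((z.re - c) ^ 2 + z.im ^ 2) := fun _ => rfl
    have fim : ∀ z, (f z).im = s * z.im / ((z.re - c) ^ 2 + z.im ^ 2) := fun _ => rfl
    have fD : ∀ z, ((f z).re - c) ^ 2 + (f z).im ^ 2 = s ^ 2 / ((z.re - c) ^ 2 + z.im ^ 2) := by
      intro z
      have := (hD z).ne'
      rw [fre, fim]
      field_simp
      ring
    have ffix : ∀ z : ℍ, (z.re - c) ^ 2 + z.im ^ 2 = s → f z = z := by
      intro z hz
      apply UpperHalfPlane.ext_re_im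
      · rw [fre, hz]
        field_simp
        ring
      · rw [fim, hz]
        field_simp
    refine key f ?_ ?_ (ffix A hs.symm) (ffix B (by rw [hs, hc])) ⟨⟨⟨c, s + 1⟩, by simp; linarith⟩, ?_⟩
    · intro z
      have := (hD z).ne'
      apply UpperHalfPlane.ext_re_im
      · rw [fre, fD, fre]
        field_simp
        ring
      · rw [fim, fD, fim]
        field_simp
    · intro z w
      have h1 := (hD z).ne'
      have h2 := (hD w).ne'
      have h3 := z.im_pos.ne'
      have h4 := w.im_pos.ne'
      simp only [cosh_dist', fre, fim]
      field_simp
      ring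
    · intro h
      have h1 := congrArg UpperHalfPlane.im h
      rw [fim] at h1
      simp only [UpperHalfPlane.re, UpperHalfPlane.im] at h1
      have : s + 1 ≠ 0 := by linarith
      field_simp at h1
      nlinarith

/-! ### Distances as values of a bilinear form -/

/-- The mixed Gram determinant of two quadruples of points of the hyperbolic plane vanishes: in the
hyperboloid model, `Real.cosh (dist z w)` is the value of a bilinear form on `ℝ³`. -/
theorem det_cosh_dist_eq_zero (u v : Fin 4 → ℍ) :
    (Matrix.of fun i j => Real.cosh (dist (u i) (v j))).det = 0 := by
  -- The points of the hyperboloid are padded with a zero to make the factors square.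
  let M : Matrix (Fin 4) (Fin 4) ℝ := Matrix.of fun i =>
    ![((u i).re ^ 2 + (u i).im ^ 2 + 1) / (2 * (u i).im), (u i).re / (u i).im,
      ((u i).re ^ 2 + (u i).im ^ 2 - 1) / (2 * (u i).im), 0]
  let N : Matrix (Fin 4) (Fin 4) ℝ := Matrix.of fun i j =>
    ![((v j).re ^ 2 + (v j).im ^ 2 + 1) / (2 * (v j).im), -((v j).re / (v j).im),
      -(((v j).re ^ 2 + (v j).im ^ 2 - 1) / (2 * (v j).im)), 0] i
  have h : (Matrix.of fun i j => Real.cosh (dist (u i) (v j))) = M * N := by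
    ext i j
    have h1 := (u i).im_pos.ne'
    have h2 := (v j).im_pos.ne'
    simp only [M, N, Matrix.mul_apply, Fin.sum_univ_four, Matrix.of_apply, cosh_dist',
      Matrix.cons_val]
    field_simp
    ring
  rw [h, Matrix.det_mul, Matrix.det_eq_zero_of_column_eq_zero (A := M) 3 (fun i => by simp [M]),
    zero_mul]

/-- The bilinear form of the hyperboloid model in the orthogonal basis obtained from the vectors of
`a`, `b` and `d`, where `b a d` is a right angle with equal legs: the differences
`cosh r * a - b` and `cosh r * a - d` are orthogonal to each other and to `a`. -/
theorem cosh_dist_of_right_angle {a b d : ℍ} {c : ℝ} (hc : 1 < c)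
    (hab : Real.cosh (dist a b) = c) (had : Real.cosh (dist a d) = c)
    (hbd : Real.cosh (dist b d) = c ^ 2) (z w : ℍ) :
    Real.cosh (dist z w) = Real.cosh (dist z a) * Real.cosh (dist w a) -
      ((c * Real.cosh (dist z a) - Real.cosh (dist z b)) *
          (c * Real.cosh (dist w a) - Real.cosh (dist w b)) +
        (c * Real.cosh (dist z a) - Real.cosh (dist z d)) *
          (c * Real.cosh (dist w a) - Real.cosh (dist w d))) / (c ^ 2 - 1) := by
  have h := det_cosh_dist_eq_zero ![z, a, b, d] ![w, a, b, d]
  have hc2 : c ^ 2 - 1 ≠ 0 := by nlinarith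
  simp only [Matrix.det_succ_row_zero, Fin.sum_univ_succ, Fin.succAbove, Matrix.of_apply,
    Matrix.submatrix_apply] at h
  simp [Fin.lt_def, dist_comm b a, dist_comm d a, dist_comm d b, hab, had, hbd,
    dist_comm _ w] at h
  simp only [dist_comm _ w]
  field_simp
  generalize Real.cosh (dist w z) = X at *
  generalize Real.cosh (dist z a) = x1 at *
  generalize Real.cosh (dist z b) = x2 at *
  generalize Real.cosh (dist z d) = x3 at *
  generalize Real.cosh (dist w a) = y1 at *
  generalize Real.cosh (dist w b) = y2 at *
  generalize Real.cosh (dist w d) = y3 at *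
  apply mul_left_cancel₀ hc2
  linear_combination h

/-! ### The regular right-angled pentagon and its frame -/

namespace IsRegularRightPentagon

variable {Q : Fin 5 → ℍ}

theorem shift (hQ : IsRegularRightPentagon Q) (i : Fin 5) :
    IsRegularRightPentagon fun j => Q (j + i) where
  injective := hQ.injective.comp (add_left_injective i)
  side_eq j := by
    have h1 := hQ.side_eq (j + i)
    have h2 := hQ.side_eq i
    rw [add_right_comm] at h1
    rw [add_comm i 1] at h2
    rw [h1, zero_add, h2]
  angle_eq j := by
    have h := hQ.angle_eq (j + i)
    rwa [add_right_comm j i 1, add_right_comm j i 2] at h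

theorem map (hQ : IsRegularRightPentagon Q) (σ : ℍ ≃ᵢ ℍ) :
    IsRegularRightPentagon fun j => σ (Q j) where
  injective := σ.injective.comp hQ.injective
  side_eq j := by simpa [σ.dist_eq] using hQ.side_eq j
  angle_eq j := by simpa [hypAngle, σ.dist_eq] using hQ.angle_eq j

/-- Two sides and a diagonal form a right triangle, whose hypotenuse is given by the hyperbolic
Pythagorean theorem. -/
theorem cosh_diagonal_eq_sq (hQ : IsRegularRightPentagon Q) (i : Fin 5) :
    Real.cosh (dist (Q i) (Q (i + 2))) = Real.cosh (dist (Q 0) (Q 1)) ^ 2 := by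
  have h := hQ.angle_eq i
  have h12 : dist (Q (i + 1)) (Q (i + 2)) = dist (Q 0) (Q 1) := by
    simpa [add_assoc] using hQ.side_eq (i + 1)
  have hpos : 0 < dist (Q 0) (Q 1) := dist_pos.2 fun h => by simpa using hQ.injective h
  have hs := (Real.sinh_pos_iff.2 hpos).ne'
  rw [hypAngle, Real.arccos_eq_pi_div_two, hQ.side_eq, h12, div_eq_zero_iff] at h
  rcases h with h | h
  · linarith
  · exact absurd h (mul_ne_zero hs hs)

/-- The side of the regular right-angled pentagon: that five points with these mutual distances
exist in dimension two is a condition on the side. -/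
theorem cosh_side (hQ : IsRegularRightPentagon Q) (i : Fin 5) :
    Real.cosh (dist (Q i) (Q (i + 1))) = φ := by
  rw [hQ.side_eq]
  obtain ⟨c, hc⟩ : ∃ c, c = Real.cosh (dist (Q 0) (Q 1)) := ⟨_, rfl⟩
  have hpos : 0 < dist (Q 0) (Q 1) := dist_pos.2 fun h => by simpa using hQ.injective h
  have hc1 : 1 < c := by rw [hc]; exact Real.one_lt_cosh.2 hpos.ne'
  have hside : ∀ i, Real.cosh (dist (Q i) (Q (i + 1))) = c := fun i => by rw [hQ.side_eq, hc]
  have hdiag : ∀ i, Real.cosh (dist (Q i) (Q (i + 2))) = c ^ 2 := fun i => by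
    rw [hQ.cosh_diagonal_eq_sq, hc]
  have h01 := hside 0
  have h40 := hside 4
  have h12 := hside 1
  have h41 := hdiag 4
  have h02 := hdiag 0
  have h24 := hdiag 2
  simp only [Fin.reduceAdd] at h01 h40 h12 h41 h02 h24
  have h := cosh_dist_of_right_angle (a := Q 0) (b := Q 1) (d := Q 4) hc1 h01
    (by rw [dist_comm, h40]) (by rw [dist_comm, h41]) (Q 2) (Q 2)
  rw [dist_self, Real.cosh_zero, dist_comm (Q 2) (Q 0), dist_comm (Q 2) (Q 1), h02, h12, h24] at h
  have hc2 : c ^ 2 - 1 ≠ 0 := by nlinarith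
  field_simp at h
  have hq : c ^ 2 = c + 1 := by
    have hne : (c - 1) ^ 2 * (c ^ 2 + c + 1) ≠ 0 := by
      have : 0 < c - 1 := by linarith
      positivity
    have := mul_left_cancel₀ hne (b := c ^ 2 - c - 1) (c := 0) (by linear_combination h)
    linarith
  rw [← hc]
  have hf : (c - φ) * (c + φ - 1) = 0 := by
    linear_combination hq - Real.goldenRatio_sq
  have := Real.one_lt_goldenRatio
  rcases mul_eq_zero.1 hf with h | h <;> linarith

theorem cosh_diagonal (hQ : IsRegularRightPentagon Q) (i : Fin 5) :
    Real.cosh (dist (Q i) (Q (i + 2))) = φ + 1 := by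
  rw [hQ.cosh_diagonal_eq_sq, ← Real.goldenRatio_sq]
  congr 1
  exact hQ.cosh_side 0

end IsRegularRightPentagon

/-- The coordinates `(t, a, b)` of a point in the frame given by the vertex `Q 0` of a regular
right-angled pentagon and its two sides at this vertex. They are coordinates in the hyperboloid
model, scaled so that the form is `t ^ 2 - φ * (a ^ 2 + b ^ 2)`; as `φ⁻¹ = φ - 1`, they are
combinations of the hyperbolic cosines of three distances with coefficients in `ℤ[φ]`. -/
def frameCoord (Q : Fin 5 → ℍ) (z : ℍ) : ℝ × ℝ × ℝ :=
  (Real.cosh (dist z (Q 0)),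
    Real.cosh (dist z (Q 0)) - (φ - 1) * Real.cosh (dist z (Q 1)),
    Real.cosh (dist z (Q 0)) - (φ - 1) * Real.cosh (dist z (Q 4)))

/-- The bilinear form of the hyperboloid model in the coordinates `frameCoord`. -/
def frameForm (x y : ℝ × ℝ × ℝ) : ℝ :=
  x.1 * y.1 - φ * (x.2.1 * y.2.1 + x.2.2 * y.2.2)

theorem frameCoord_map (Q : Fin 5 → ℍ) (σ : ℍ ≃ᵢ ℍ) (z : ℍ) :
    frameCoord (fun j => σ (Q j)) (σ z) = frameCoord Q z := by
  simp only [frameCoord, σ.dist_eq]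

namespace IsRegularRightPentagon

variable {Q : Fin 5 → ℍ}

theorem cosh_dist (hQ : IsRegularRightPentagon Q) (z w : ℍ) :
    Real.cosh (dist z w) = frameForm (frameCoord Q z) (frameCoord Q w) := by
  have h40 := hQ.cosh_side 4
  have h41 := hQ.cosh_diagonal 4
  simp only [Fin.reduceAdd] at h40 h41
  have hφ := Real.goldenRatio_sq
  rw [cosh_dist_of_right_angle Real.one_lt_goldenRatio (hQ.cosh_side 0)
    (by rw [dist_comm, h40]) (by rw [dist_comm, zero_add, h41, hφ]) z w,
    hφ, add_sub_cancel_right, sub_eq_iff_eq_add, frameForm, frameCoord, frameCoord]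
  have := Real.goldenRatio_ne_zero
  -- `φ` is replaced by a variable, as otherwise `ring` unfolds it to an expression in `√5`.
  generalize φ = g at *
  field_simp
  simp only [zero_add]
  generalize Real.cosh (dist z (Q 0)) = x1
  generalize Real.cosh (dist z (Q 1)) = x2
  generalize Real.cosh (dist z (Q 4)) = x3
  generalize Real.cosh (dist w (Q 0)) = y1
  generalize Real.cosh (dist w (Q 1)) = y2
  generalize Real.cosh (dist w (Q 4)) = y3
  linear_combination -(g * x2 * y1 + g * x1 * y2 - (g ^ 2 - g + 1) * x2 * y2 +
    (g * x3 * y1 + g * x1 * y3 - (g ^ 2 - g + 1) * x3 * y3)) * hφ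

theorem frameForm_self (hQ : IsRegularRightPentagon Q) (z : ℍ) :
    frameForm (frameCoord Q z) (frameCoord Q z) = 1 := by
  rw [← hQ.cosh_dist, dist_self, Real.cosh_zero]

theorem frameCoord_injective (hQ : IsRegularRightPentagon Q) :
    Function.Injective (frameCoord Q) := by
  intro z w h
  have := hQ.cosh_dist z w
  rw [h, hQ.frameForm_self] at this
  by_contra hne
  exact (Real.one_lt_cosh.2 (dist_pos.2 hne).ne').ne' this

theorem frameCoord_vertex (hQ : IsRegularRightPentagon Q) :
    frameCoord Q (Q 0) = (1, 0, 0) ∧ frameCoord Q (Q 1) = (φ, 1, 0) ∧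
      frameCoord Q (Q 2) = (φ + 1, φ, 1) ∧ frameCoord Q (Q 3) = (φ + 1, 1, φ) ∧
      frameCoord Q (Q 4) = (φ, 0, 1) := by
  have hφ := Real.goldenRatio_sq
  have s0 := hQ.cosh_side 0
  have s1 := hQ.cosh_side 1
  have s3 := hQ.cosh_side 3
  have s4 := hQ.cosh_side 4
  have d0 := hQ.cosh_diagonal 0
  have d1 := hQ.cosh_diagonal 1
  have d2 := hQ.cosh_diagonal 2
  have d3 := hQ.cosh_diagonal 3
  have d4 := hQ.cosh_diagonal 4
  simp only [Fin.reduceAdd] at s0 s1 s3 s4 d0 d1 d2 d3 d4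
  simp only [frameCoord, Prod.mk.injEq, dist_self, Real.cosh_zero, dist_comm (Q 1) (Q 0),
    dist_comm (Q 2) (Q 0), dist_comm (Q 2) (Q 1), dist_comm (Q 3) (Q 1), dist_comm (Q 0) (Q 4),
    dist_comm (Q 1) (Q 4), s0, s1, s3, s4, d0, d1, d2, d3, d4]
  generalize φ = g at hφ ⊢
  refine ⟨⟨?_, ?_, ?_⟩, ⟨?_, ?_, ?_⟩, ⟨?_, ?_, ?_⟩, ⟨?_, ?_, ?_⟩, ?_, ?_, ?_⟩ <;>
    grind

end IsRegularRightPentagon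

/-! ### Integrality of the vertices over the ring of the golden ratio -/

/-- The ring `ℤ[φ]` generated by the golden ratio. -/
def goldenIntegers : Subring ℝ where
  carrier := {x | ∃ m n : ℤ, x = m + n * φ}
  zero_mem' := ⟨0, 0, by simp⟩
  one_mem' := ⟨1, 0, by simp⟩
  add_mem' := by
    rintro _ _ ⟨m, n, rfl⟩ ⟨k, l, rfl⟩
    exact ⟨m + k, n + l, by push_cast; ring⟩
  neg_mem' := by
    rintro _ ⟨m, n, rfl⟩
    exact ⟨-m, -n, by push_cast; ring⟩
  mul_mem' := by
    rintro _ _ ⟨m, n, rfl⟩ ⟨k, l, rfl⟩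
    refine ⟨m * k + n * l, m * l + n * k + n * l, ?_⟩
    push_cast
    linear_combination (n * l : ℝ) * Real.goldenRatio_sq

theorem goldenRatio_mem_goldenIntegers : φ ∈ goldenIntegers := ⟨0, 1, by simp⟩

/-- The circle `a ^ 2 + b ^ 2 = 1` has only four points with coordinates in `ℤ[φ]`: for
`a = m + n * φ` and `b = k + l * φ`, comparing coefficients in the basis `1, φ` gives
`m ^ 2 + n ^ 2 + k ^ 2 + l ^ 2 = 1`. -/
theorem eq_of_sq_add_sq_eq_one {a b : ℝ} (ha : a ∈ goldenIntegers) (hb : b ∈ goldenIntegers)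
    (h : a ^ 2 + b ^ 2 = 1) :
    (a = 1 ∧ b = 0) ∨ (a = -1 ∧ b = 0) ∨ (a = 0 ∧ b = 1) ∨ (a = 0 ∧ b = -1) := by
  obtain ⟨m, n, rfl⟩ := ha
  obtain ⟨k, l, rfl⟩ := hb
  have h1 : ((m ^ 2 + n ^ 2 + k ^ 2 + l ^ 2 - 1 : ℤ) : ℝ) +
      ((2 * m * n + n ^ 2 + 2 * k * l + l ^ 2 : ℤ) : ℝ) * φ = 0 := by
    push_cast
    linear_combination h - ((n : ℝ) ^ 2 + (l : ℝ) ^ 2) * Real.goldenRatio_sq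
  have h2 : 2 * m * n + n ^ 2 + 2 * k * l + l ^ 2 = 0 := by
    by_contra hne
    exact ((Real.goldenRatio_irrational.intCast_mul hne).intCast_add _).ne_zero h1
  have h3 : m ^ 2 + n ^ 2 + k ^ 2 + l ^ 2 = 1 := by
    rw [h2] at h1
    simp only [Int.cast_zero, zero_mul, add_zero, Int.cast_eq_zero] at h1
    linarith
  have hm : -1 ≤ m ∧ m ≤ 1 := by constructor <;> nlinarith
  have hn : -1 ≤ n ∧ n ≤ 1 := by constructor <;> nlinarith
  have hk : -1 ≤ k ∧ k ≤ 1 := by constructor <;> nlinarith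
  have hl : -1 ≤ l ∧ l ≤ 1 := by constructor <;> nlinarith
  have hn0 : n = 0 := by
    by_contra hne
    have : 1 ≤ n ^ 2 := by have := sq_pos_of_ne_zero hne; linarith
    have hm0 : m = 0 := by nlinarith
    have hk0 : k = 0 := by nlinarith
    have hl0 : l = 0 := by nlinarith
    subst hm0 hk0 hl0
    omega
  subst hn0
  have hl0 : l = 0 := by
    by_contra hne
    have : 1 ≤ l ^ 2 := by have := sq_pos_of_ne_zero hne; linarith
    have hm0 : m = 0 := by nlinarith
    have hk0 : k = 0 := by nlinarith
    subst hm0 hk0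
    omega
  subst hl0
  obtain ⟨hm1, hm2⟩ := hm
  obtain ⟨hk1, hk2⟩ := hk
  interval_cases m <;> interval_cases k <;> simp at h3 ⊢

/-- The points with coordinates in `ℤ[φ]` in the frame of the pentagon `Q`. -/
def IsGoldenPoint (Q : Fin 5 → ℍ) (z : ℍ) : Prop :=
  (frameCoord Q z).1 ∈ goldenIntegers ∧ (frameCoord Q z).2.1 ∈ goldenIntegers ∧
    (frameCoord Q z).2.2 ∈ goldenIntegers

theorem isGoldenPoint_map (Q : Fin 5 → ℍ) (σ : ℍ ≃ᵢ ℍ) (z : ℍ) :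
    IsGoldenPoint (fun j => σ (Q j)) (σ z) ↔ IsGoldenPoint Q z := by
  rw [IsGoldenPoint, frameCoord_map, IsGoldenPoint]

namespace IsRegularRightPentagon

variable {Q : Fin 5 → ℍ}

/-- The change of frame between consecutive vertices of the pentagon has coefficients in `ℤ[φ]`. -/
theorem isGoldenPoint_shift_one (hQ : IsRegularRightPentagon Q) {z : ℍ} (hz : IsGoldenPoint Q z) :
    IsGoldenPoint (fun j => Q (j + 1)) z := by
  obtain ⟨ht, ha, hb⟩ := hz
  obtain ⟨v0, v1, v2, -⟩ := hQ.frameCoord_vertex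
  have e : frameCoord (fun j => Q (j + 1)) z =
      (φ * ((frameCoord Q z).1 - (frameCoord Q z).2.1), (frameCoord Q z).2.2,
        φ * ((frameCoord Q z).1 - (frameCoord Q z).2.1) - (φ - 1) * (frameCoord Q z).1) := by
    conv_lhs => rw [frameCoord]
    simp only [Fin.reduceAdd, hQ.cosh_dist z, v0, v1, v2, frameForm, Prod.mk.injEq]
    generalize (frameCoord Q z).1 = t
    generalize (frameCoord Q z).2.1 = a
    generalize (frameCoord Q z).2.2 = b
    have hφ := Real.goldenRatio_sq
    generalize φ = g at *
    refine ⟨?_, ?_, ?_⟩ <;> grind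
  have hφ := goldenRatio_mem_goldenIntegers
  have h1 := mul_mem hφ (sub_mem ht ha)
  rw [IsGoldenPoint, e]
  exact ⟨h1, hb, sub_mem h1 (mul_mem (sub_mem hφ (one_mem _)) ht)⟩

theorem isGoldenPoint_shift (hQ : IsRegularRightPentagon Q) {z : ℍ} (hz : IsGoldenPoint Q z)
    (i : Fin 5) : IsGoldenPoint (fun j => Q (j + i)) z := by
  have h : ∀ n : ℕ, IsGoldenPoint (fun j => Q (j + (Fin.ofNat 5 n))) z := by
    intro n
    induction n with
    | zero => simpa using hz
    | succ n ih =>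
      have := (hQ.shift _).isGoldenPoint_shift_one ih
      convert this using 3 with j
      rw [add_assoc]
      congr 1
      ext
      simp [Fin.val_add, add_comm]
  simpa using h i

/-- An isometry fixing the ends of the side `Q 0`, `Q 1` preserves the first two coordinates, hence
the last one up to its sign. -/
theorem isGoldenPoint_of_fixes_side_zero (hQ : IsRegularRightPentagon Q) {σ : ℍ ≃ᵢ ℍ}
    (h0 : σ (Q 0) = Q 0) (h1 : σ (Q 1) = Q 1) {z : ℍ} (hz : IsGoldenPoint Q z) :
    IsGoldenPoint Q (σ z) := by
  have d0 : dist (σ z) (Q 0) = dist z (Q 0) := by rw [← h0, σ.dist_eq, h0]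
  have d1 : dist (σ z) (Q 1) = dist z (Q 1) := by rw [← h1, σ.dist_eq, h1]
  have et : (frameCoord Q (σ z)).1 = (frameCoord Q z).1 := by simp only [frameCoord, d0]
  have ea : (frameCoord Q (σ z)).2.1 = (frameCoord Q z).2.1 := by simp only [frameCoord, d0, d1]
  have n1 := hQ.frameForm_self z
  have n2 := hQ.frameForm_self (σ z)
  rw [frameForm] at n1 n2
  rw [et, ea] at n2
  have e : φ * ((frameCoord Q (σ z)).2.2 * (frameCoord Q (σ z)).2.2) =
      φ * ((frameCoord Q z).2.2 * (frameCoord Q z).2.2) := by linear_combination n1 - n2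
  have hb := mul_self_eq_mul_self_iff.1 (mul_left_cancel₀ Real.goldenRatio_ne_zero e)
  rw [IsGoldenPoint, et, ea]
  refine ⟨hz.1, hz.2.1, ?_⟩
  rcases hb with hb | hb <;> rw [hb]
  · exact hz.2.2
  · exact neg_mem hz.2.2

theorem isGoldenPoint_of_fixes_side (hQ : IsRegularRightPentagon Q) {σ : ℍ ≃ᵢ ℍ} (i : Fin 5)
    (h0 : σ (Q i) = Q i) (h1 : σ (Q (i + 1)) = Q (i + 1)) {z : ℍ} (hz : IsGoldenPoint Q z) :
    IsGoldenPoint Q (σ z) := by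
  have h := (hQ.shift i).isGoldenPoint_of_fixes_side_zero (σ := σ) (by simpa using h0)
    (by simpa [add_comm] using h1) (hQ.isGoldenPoint_shift hz i)
  simpa [add_assoc] using (hQ.shift i).isGoldenPoint_shift h (-i)

theorem isGoldenPoint_vertex (hQ : IsRegularRightPentagon Q) (i : Fin 5) :
    IsGoldenPoint Q (Q i) := by
  have h0 : IsGoldenPoint (fun j => Q (j + i)) (Q i) := by
    have := (hQ.shift i).frameCoord_vertex.1
    rw [zero_add] at this
    rw [IsGoldenPoint, this]
    exact ⟨one_mem _, zero_mem _, zero_mem _⟩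
  simpa [add_assoc] using (hQ.shift i).isGoldenPoint_shift h0 (-i)

end IsRegularRightPentagon

/-! ### Tiles -/

theorem IsReflectionInLine.inv {A B : ℍ} {σ : ℍ ≃ᵢ ℍ} (h : IsReflectionInLine A B σ) :
    IsReflectionInLine A B σ⁻¹ :=
  ⟨inv_ne_one.2 h.1, σ.injective (by simp [h.2.1]), σ.injective (by simp [h.2.2])⟩

theorem IsReflectionInLine.conj {A B : ℍ} {σ : ℍ ≃ᵢ ℍ} (h : IsReflectionInLine A B σ)
    (τ : ℍ ≃ᵢ ℍ) : IsReflectionInLine (τ A) (τ B) (τ * σ * τ⁻¹) :=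
  ⟨fun e => h.1 (conj_eq_one_iff.1 e), by simp [h.2.1], by simp [h.2.2]⟩

namespace IsTile

variable {P Q R : Fin 5 → ℍ}

theorem trans (hQ : IsTile P Q) (hR : IsTile Q R) : IsTile P R := by
  induction hR with
  | base => exact hQ
  | reflect R S i σ _ _ hσ ih1 ih2 => exact .reflect R S i σ ih1 ih2 hσ

theorem map (hQ : IsTile P Q) (τ : ℍ ≃ᵢ ℍ) : IsTile (fun j => τ (P j)) (fun j => τ (Q j)) := by
  induction hQ with
  | base => exact .base
  | reflect Q R i σ _ _ hσ ih1 ih2 =>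
    simpa using IsTile.reflect _ _ i (τ * σ * τ⁻¹) ih1 ih2 (hσ.conj τ)

/-- Any tile generates the tessellation. -/
theorem symm (hQ : IsTile P Q) : IsTile Q P := by
  induction hQ with
  | base => exact .base
  | reflect Q R i σ _ hR hσ ih1 _ =>
    have h1 := ih1.map σ
    have h3 := IsTile.reflect _ _ i σ⁻¹ .base (hR.map σ) (by
      simpa [hσ.2.1, hσ.2.2] using hσ.inv)
    exact h1.trans (by simpa using h3)

theorem shift (hQ : IsTile P Q) (i : Fin 5) : IsTile (fun j => P (j + i)) (fun j => Q (j + i)) := by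
  induction hQ with
  | base => exact .base
  | reflect Q R k σ _ _ hσ ih1 ih2 =>
    exact IsTile.reflect _ _ (k - i) σ ih1 ih2 (by
      rw [sub_add_cancel, sub_add_eq_add_sub, sub_add_cancel]
      exact hσ)

theorem isRegularRightPentagon (hQ : IsTile P Q) (hP : IsRegularRightPentagon P) :
    IsRegularRightPentagon Q := by
  induction hQ with
  | base => exact hP
  | reflect Q R i σ _ _ hσ ih1 ih2 => exact ih1.map σ

/-- All the tiles define the same points with coordinates in `ℤ[φ]`. -/
theorem isGoldenPoint_iff (hQ : IsTile P Q) (hP : IsRegularRightPentagon P) (z : ℍ) :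
    IsGoldenPoint Q z ↔ IsGoldenPoint P z := by
  induction hQ generalizing z with
  | base => rfl
  | reflect Q R i σ _ hR hσ ih1 ih2 =>
    have hRP := hR.isRegularRightPentagon hP
    have h := isGoldenPoint_map Q σ (σ⁻¹ z)
    rw [show σ (σ⁻¹ z) = z by simp] at h
    rw [h, ih1, ← ih2, ← ih2]
    refine ⟨fun hz => ?_, hRP.isGoldenPoint_of_fixes_side i hσ.inv.2.1 hσ.inv.2.2⟩
    simpa using hRP.isGoldenPoint_of_fixes_side i hσ.2.1 hσ.2.2 hz

end IsTile

theorem IsRegularRightPentagon.isGoldenPoint_of_mem {P : Fin 5 → ℍ} (hP : IsRegularRightPentagon P)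
    {z : ℍ} (hz : z ∈ gridVertices P) : IsGoldenPoint P z := by
  obtain ⟨Q, hQ, i, rfl⟩ := hz
  exact (hQ.isGoldenPoint_iff hP _).1 ((hQ.isRegularRightPentagon hP).isGoldenPoint_vertex i)

/-- The vertices of the tessellation are equivalent: each is the first vertex of a tile, numbered
anew, which generates the same vertices. -/
theorem exists_pentagon_at_vertex {P : Fin 5 → ℍ} (hP : IsRegularRightPentagon P) {v : ℍ}
    (hv : v ∈ gridVertices P) :
    ∃ Q, IsRegularRightPentagon Q ∧ Q 0 = v ∧ gridVertices Q = gridVertices P := by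
  obtain ⟨Q, hQ, i, rfl⟩ := hv
  refine ⟨fun j => Q (j + i), (hQ.isRegularRightPentagon hP).shift i, by simp, ?_⟩
  ext z
  constructor
  · rintro ⟨R, hR, j, rfl⟩
    have := hR.shift (-i)
    simp only [neg_add_cancel_right] at this
    exact ⟨_, hQ.trans this, j + i, by simp⟩
  · rintro ⟨R, hR, j, rfl⟩
    exact ⟨_, (hQ.symm.trans hR).shift i, j - i, by simp⟩

/-! ### The vertices near a given vertex -/

theorem goldenRatio_gt : 1.6 < φ := by
  have := Real.goldenRatio_sq
  have := Real.one_lt_goldenRatio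
  nlinarith

/-- `(c, d)` is one of the four unit vectors on the coordinate axes. -/
def IsAxisVector (c d : ℝ) : Prop :=
  (c = 1 ∧ d = 0) ∨ (c = -1 ∧ d = 0) ∨ (c = 0 ∧ d = 1) ∨ (c = 0 ∧ d = -1)

theorem IsAxisVector.mem {c d : ℝ} (h : IsAxisVector c d) :
    c ∈ goldenIntegers ∧ d ∈ goldenIntegers ∧ c ^ 2 + d ^ 2 = 1 := by
  have one := one_mem goldenIntegers
  have zero := zero_mem goldenIntegers
  rcases h with ⟨rfl, rfl⟩ | ⟨rfl, rfl⟩ | ⟨rfl, rfl⟩ | ⟨rfl, rfl⟩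
  · exact ⟨one, zero, by norm_num⟩
  · exact ⟨neg_mem one, zero, by norm_num⟩
  · exact ⟨zero, one, by norm_num⟩
  · exact ⟨zero, neg_mem one, by norm_num⟩

namespace IsRegularRightPentagon

variable {Q : Fin 5 → ℍ}

/-- A point with coordinates in `ℤ[φ]` at the distance of a side from the first vertex is one of
four, in perpendicular directions. -/
theorem frameCoord_of_neighbor (hQ : IsRegularRightPentagon Q) {z : ℍ} (hz : IsGoldenPoint Q z)
    (h : Real.cosh (dist z (Q 0)) = φ) :
    ∃ c d, IsAxisVector c d ∧ frameCoord Q z = (φ, c, d) := by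
  have hn := hQ.frameForm_self z
  obtain ⟨-, ha, hb⟩ := hz
  rw [hQ.cosh_dist, hQ.frameCoord_vertex.1] at h
  generalize frameCoord Q z = x at *
  obtain ⟨t, a, b⟩ := x
  simp only [frameForm] at *
  have ht : t = φ := by linarith
  subst ht
  refine ⟨a, b, eq_of_sq_add_sq_eq_one ha hb ?_, rfl⟩
  apply mul_left_cancel₀ Real.goldenRatio_ne_zero
  linear_combination Real.goldenRatio_sq - hn

/-- The neighbours of the neighbour `y` of the first vertex in the unit direction `(c, d)`, with
coordinates in `ℤ[φ]`: the first vertex, its image under the central symmetry at `y`, and one on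
each side of the line through these. -/
theorem frameCoord_of_second_neighbor (hQ : IsRegularRightPentagon Q) {y z : ℍ} {c d : ℝ}
    (hcd : IsAxisVector c d)
    (hy : frameCoord Q y = (φ, c, d)) (hz : IsGoldenPoint Q z)
    (h : Real.cosh (dist z y) = φ) :
    frameCoord Q z = (1, 0, 0) ∨ frameCoord Q z = (2 * φ + 1, 2 * φ * c, 2 * φ * d) ∨
      frameCoord Q z = (φ + 1, φ * c - d, φ * d + c) ∨
      frameCoord Q z = (φ + 1, φ * c + d, φ * d - c) := by
  have hn := hQ.frameForm_self z
  obtain ⟨hc, hd, hcd⟩ := hcd.mem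
  obtain ⟨-, ha, hb⟩ := hz
  rw [hQ.cosh_dist, hy] at h
  generalize frameCoord Q z = x at *
  obtain ⟨t, a, b⟩ := x
  simp only [frameForm] at *
  have hφ := Real.goldenRatio_sq
  have hφm := goldenRatio_mem_goldenIntegers
  -- The coordinates along the direction `(c, d)` and across it.
  obtain ⟨u, hu⟩ : ∃ u, u = c * a + d * b := ⟨_, rfl⟩
  obtain ⟨w, hw⟩ : ∃ w, w = c * b - d * a := ⟨_, rfl⟩
  have hum : u ∈ goldenIntegers := hu ▸ add_mem (mul_mem hc ha) (mul_mem hd hb)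
  have hwm : w ∈ goldenIntegers := hw ▸ sub_mem (mul_mem hc hb) (mul_mem hd ha)
  have hua : a = c * u - d * w := by rw [hu, hw]; linear_combination -a * hcd
  have hub : b = d * u + c * w := by rw [hu, hw]; linear_combination -b * hcd
  have ht : t = u + 1 := by
    apply mul_left_cancel₀ Real.goldenRatio_ne_zero
    rw [hu]
    linear_combination h
  have hn' : (u + 1) ^ 2 - φ * (u ^ 2 + w ^ 2) = 1 := by
    rw [ht, hua, hub] at hn
    linear_combination hn + φ * (u ^ 2 + w ^ 2) * hcd
  have huφ : ((φ - 1) * u - 1) ^ 2 + w ^ 2 = 1 := by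
    generalize φ = g at *
    linear_combination (1 - g) * hn' - w ^ 2 * hφ
  have := eq_of_sq_add_sq_eq_one
    (sub_mem (mul_mem (sub_mem hφm (one_mem _)) hum) (one_mem _)) hwm huφ
  have hk : u = φ * ((φ - 1) * u - 1) + φ := by
    generalize φ = g at *
    linear_combination -u * hφ
  rcases this with ⟨h1, h2⟩ | ⟨h1, h2⟩ | ⟨h1, h2⟩ | ⟨h1, h2⟩ <;> rw [h1] at hk <;>
    rw [ht, hua, hub, hk, h2] <;> generalize φ = g
  · right; left; ext <;> ring
  · left; ext <;> ring
  · right; right; left; ext <;> ring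
  · right; right; right; ext <;> ring

/-- There are no quadrilaterals. -/
theorem eq_of_common_neighbors (hQ : IsRegularRightPentagon Q) {x y z : ℍ}
    (hx : IsGoldenPoint Q x) (hy : IsGoldenPoint Q y) (hz : IsGoldenPoint Q z)
    (hx0 : Real.cosh (dist x (Q 0)) = φ) (hy0 : Real.cosh (dist y (Q 0)) = φ)
    (hzx : Real.cosh (dist z x) = φ) (hzy : Real.cosh (dist z y) = φ) (hxy : x ≠ y) :
    z = Q 0 := by
  have hne := hQ.frameCoord_injective.ne hxy
  have hφ := Real.goldenRatio_sq
  have hgt := goldenRatio_gt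
  obtain ⟨c, d, hcd, hxc⟩ := hQ.frameCoord_of_neighbor hx hx0
  obtain ⟨c', d', hcd', hyc⟩ := hQ.frameCoord_of_neighbor hy hy0
  rw [hQ.cosh_dist, hyc] at hzy
  rw [hxc, hyc] at hne
  rcases hQ.frameCoord_of_second_neighbor hcd hxc hz hzx with h | h | h | h
  · exact hQ.frameCoord_injective (h.trans hQ.frameCoord_vertex.1.symm)
  all_goals
    exfalso
    rw [h, frameForm] at hzy
    simp only [ne_eq, Prod.mk.injEq, true_and] at hne
    clear h hxc hyc hx0 hy0 hzx hxy hx hy hz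
    generalize φ = g at *
    rcases hcd with ⟨rfl, rfl⟩ | ⟨rfl, rfl⟩ | ⟨rfl, rfl⟩ | ⟨rfl, rfl⟩ <;>
    rcases hcd' with ⟨rfl, rfl⟩ | ⟨rfl, rfl⟩ | ⟨rfl, rfl⟩ | ⟨rfl, rfl⟩ <;>
    grind

end IsRegularRightPentagon

/-- The image of the first vertex under the central symmetry at a neighbour is too far away to lie on
a pentagon through the first vertex. -/
theorem frameForm_central_image_ne {c d c' d' : ℝ} (hcd : IsAxisVector c d)
    (hcd' : IsAxisVector c' d') (hne : ¬(c = c' ∧ d = d')) {y : ℝ × ℝ × ℝ}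
    (hy : y = (2 * φ + 1, 2 * φ * c', 2 * φ * d') ∨ y = (φ + 1, φ * c' - d', φ * d' + c') ∨
      y = (φ + 1, φ * c' + d', φ * d' - c')) :
    frameForm (2 * φ + 1, 2 * φ * c, 2 * φ * d) y ≠ φ := by
  intro h
  have hφ := Real.goldenRatio_sq
  have hgt := goldenRatio_gt
  rcases hy with rfl | rfl | rfl <;> rw [frameForm] at h <;> simp only at h <;>
    generalize φ = g at * <;>
    rcases hcd with ⟨rfl, rfl⟩ | ⟨rfl, rfl⟩ | ⟨rfl, rfl⟩ | ⟨rfl, rfl⟩ <;>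
    rcases hcd' with ⟨rfl, rfl⟩ | ⟨rfl, rfl⟩ | ⟨rfl, rfl⟩ | ⟨rfl, rfl⟩ <;>
    grind

/-- When the second neighbours `x` and `y` of a vertex, through its neighbours in the directions
`(c, d)` and `(c', d')`, are at the distance of a side, these directions are perpendicular. Up to
the order, they are `(ε, 0)` and `(0, δ)`. -/
theorem exists_sign_of_frameForm_eq {c d c' d' : ℝ} (hcd : IsAxisVector c d)
    (hcd' : IsAxisVector c' d') (hne : ¬(c = c' ∧ d = d')) {x y : ℝ × ℝ × ℝ}
    (hx : x = (φ + 1, φ * c - d, φ * d + c) ∨ x = (φ + 1, φ * c + d, φ * d - c))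
    (hy : y = (φ + 1, φ * c' - d', φ * d' + c') ∨ y = (φ + 1, φ * c' + d', φ * d' - c'))
    (h : frameForm x y = φ) :
    ∃ ε ∈ ({1, -1} : Set ℝ), ∃ δ ∈ ({1, -1} : Set ℝ),
      (((φ, c, d) = (φ, ε, 0) ∧ x = (φ + 1, φ * ε, δ) ∧
        y = (φ + 1, ε, φ * δ) ∧ (φ, c', d') = (φ, 0, δ)) ∨
      ((φ, c', d') = (φ, ε, 0) ∧ y = (φ + 1, φ * ε, δ) ∧
        x = (φ + 1, ε, φ * δ) ∧ (φ, c, d) = (φ, 0, δ))) := by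
  have hφ := Real.goldenRatio_sq
  have hgt := goldenRatio_gt
  rcases hx with rfl | rfl <;> rcases hy with rfl | rfl <;> rw [frameForm] at h <;>
    simp only at h <;> generalize φ = g at * <;>
    simp only [Set.mem_insert_iff, Set.mem_singleton_iff, Prod.mk.injEq, true_and] <;>
    rcases hcd with ⟨rfl, rfl⟩ | ⟨rfl, rfl⟩ | ⟨rfl, rfl⟩ | ⟨rfl, rfl⟩ <;>
    rcases hcd' with ⟨rfl, rfl⟩ | ⟨rfl, rfl⟩ | ⟨rfl, rfl⟩ | ⟨rfl, rfl⟩ <;>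
    first
    | (exfalso; grind)
    | (refine ⟨1, by simp, 1, by simp, ?_⟩; norm_num; done)
    | (refine ⟨1, by simp, -1, by simp, ?_⟩; norm_num; done)
    | (refine ⟨-1, by simp, 1, by simp, ?_⟩; norm_num; done)
    | (refine ⟨-1, by simp, -1, by simp, ?_⟩; norm_num)

/-- The images under the symmetries of the vertex `Q 0` of the coordinates of the pentagon `Q`, in
cyclic order. -/
def pentagonCoord (ε δ : ℝ) : Fin 5 → ℝ × ℝ × ℝ :=
  ![(1, 0, 0), (φ, ε, 0), (φ + 1, φ * ε, δ), (φ + 1, ε, φ * δ), (φ, 0, δ)]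

namespace IsRegularRightPentagon

variable {Q : Fin 5 → ℍ}

/-- The only pentagons through the first vertex are the four images of `Q` under the symmetries of
this vertex. -/
theorem exists_range_eq_pentagonCoord (hQ : IsRegularRightPentagon Q) {x : Fin 5 → ℍ}
    (hx : ∀ i, IsGoldenPoint Q (x i)) (hinj : Function.Injective x) (hx0 : x 0 = Q 0)
    (hside : ∀ i, Real.cosh (dist (x i) (x (i + 1))) = φ) :
    ∃ ε ∈ ({1, -1} : Set ℝ), ∃ δ ∈ ({1, -1} : Set ℝ),
      Set.range (frameCoord Q ∘ x) = Set.range (pentagonCoord ε δ) := by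
  have hφ := Real.goldenRatio_sq
  have hgt := goldenRatio_gt
  have hQ0 := hQ.frameCoord_vertex.1
  have s0 := hside 0
  have s1 := hside 1
  have s2 := hside 2
  have s3 := hside 3
  have s4 := hside 4
  simp only [Fin.reduceAdd] at s0 s1 s2 s3 s4
  rw [dist_comm, hx0] at s0
  rw [hx0] at s4
  rw [dist_comm] at s1
  obtain ⟨c, d, hcd, h1⟩ := hQ.frameCoord_of_neighbor (hx 1) s0
  obtain ⟨c', d', hcd', h4⟩ := hQ.frameCoord_of_neighbor (hx 4) s4
  have h2 := hQ.frameCoord_of_second_neighbor hcd h1 (hx 2) s1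
  have h3 := hQ.frameCoord_of_second_neighbor hcd' h4 (hx 3) s3
  have h2' : frameCoord Q (x 2) ≠ (1, 0, 0) := by
    rw [← hQ0, ← hx0]
    exact hQ.frameCoord_injective.ne (hinj.ne (by decide))
  have h3' : frameCoord Q (x 3) ≠ (1, 0, 0) := by
    rw [← hQ0, ← hx0]
    exact hQ.frameCoord_injective.ne (hinj.ne (by decide))
  have h14 : frameCoord Q (x 1) ≠ frameCoord Q (x 4) :=
    hQ.frameCoord_injective.ne (hinj.ne (by decide))
  have h0 : frameCoord Q (x 0) = (1, 0, 0) := by rw [hx0, hQ0]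
  rw [hQ.cosh_dist] at s2
  replace h2 := h2.resolve_left h2'
  replace h3 := h3.resolve_left h3'
  replace h14 : ¬(c = c' ∧ d = d') := by
    rw [h1, h4] at h14
    simpa using h14
  replace h2 := h2.resolve_left fun h => frameForm_central_image_ne hcd hcd' h14 h3 (by rw [← h, s2])
  replace h3 := h3.resolve_left fun h => frameForm_central_image_ne hcd' hcd
    (fun e => h14 ⟨e.1.symm, e.2.symm⟩) (.inr h2) (by rw [← h, ← hQ.cosh_dist, dist_comm,
      hQ.cosh_dist, s2])
  obtain ⟨ε, hε, δ, hδ, h⟩ := exists_sign_of_frameForm_eq hcd hcd' h14 h2 h3 s2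
  rw [← h1, ← h4] at h
  refine ⟨ε, hε, δ, hδ, ?_⟩
  rcases h with ⟨k1, k2, k3, k4⟩ | ⟨k4, k3, k2, k1⟩
  · congr 1
    funext i
    fin_cases i
    exacts [h0, k1, k2, k3, k4]
  · rw [← (Equiv.neg (Fin 5)).surjective.range_comp (pentagonCoord ε δ)]
    congr 1
    funext i
    fin_cases i
    exacts [h0, k1, k2, k3, k4]

/-- A nontrivial isometry that fixes the side `Q 0`, `Q 1` has no fixed point off its line. -/
theorem eq_one_of_fixes (hQ : IsRegularRightPentagon Q) {σ : ℍ ≃ᵢ ℍ} (h0 : σ (Q 0) = Q 0)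
    (h1 : σ (Q 1) = Q 1) {z : ℍ} (hz : σ z = z) (hb : (frameCoord Q z).2.2 ≠ 0) : σ = 1 := by
  ext1 w
  apply hQ.frameCoord_injective
  have d0 : dist (σ w) (Q 0) = dist w (Q 0) := by rw [← h0, σ.dist_eq, h0]
  have d1 : dist (σ w) (Q 1) = dist w (Q 1) := by rw [← h1, σ.dist_eq, h1]
  have et : (frameCoord Q (σ w)).1 = (frameCoord Q w).1 := by simp only [frameCoord, d0]
  have ea : (frameCoord Q (σ w)).2.1 = (frameCoord Q w).2.1 := by simp only [frameCoord, d0, d1]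
  have h : Real.cosh (dist z (σ w)) = Real.cosh (dist z w) := by
    conv_lhs => rw [← hz, σ.dist_eq]
  rw [hQ.cosh_dist, hQ.cosh_dist, frameForm, frameForm, et, ea] at h
  have eb : (frameCoord Q (σ w)).2.2 = (frameCoord Q w).2.2 := by
    apply mul_left_cancel₀ (mul_ne_zero Real.goldenRatio_ne_zero hb)
    linear_combination -h
  exact Prod.ext et (Prod.ext ea eb)

/-- Two tiles that are images of each other under the reflection in a common side meet exactly in
the ends of this side. -/
theorem range_inter_range_reflection (hQ : IsRegularRightPentagon Q) {σ : ℍ ≃ᵢ ℍ}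
    (hσ : IsReflectionInLine (Q 0) (Q 1) σ) :
    Set.range Q ∩ Set.range (fun j => σ (Q j)) = {Q 0, Q 1} := by
  obtain ⟨hσ1, h0, h1⟩ := hσ
  obtain ⟨v0, v1, v2, v3, v4⟩ := hQ.frameCoord_vertex
  have hgt := goldenRatio_gt
  apply Set.Subset.antisymm
  · rintro _ ⟨⟨k, rfl⟩, ⟨j, hj⟩⟩
    have hj : σ (Q j) = Q k := hj
    -- The first two coordinates of a vertex are preserved and determine it.
    have d0 : dist (Q k) (Q 0) = dist (Q j) (Q 0) := by rw [← hj, ← h0, σ.dist_eq, h0]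
    have d1 : dist (Q k) (Q 1) = dist (Q j) (Q 1) := by rw [← hj, ← h1, σ.dist_eq, h1]
    have et : (frameCoord Q (Q k)).1 = (frameCoord Q (Q j)).1 := by simp only [frameCoord, d0]
    have ea : (frameCoord Q (Q k)).2.1 = (frameCoord Q (Q j)).2.1 := by
      simp only [frameCoord, d0, d1]
    have hjk : j = k := by
      generalize φ = g at *
      fin_cases j <;> fin_cases k <;>
        simp only [Fin.reduceFinMk, Fin.zero_eta, Fin.mk_one, v0, v1, v2, v3, v4] at et ea ⊢ <;>
        exfalso <;> linarith
    subst hjk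
    have hb : (frameCoord Q (Q j)).2.2 = 0 := by
      by_contra hb
      exact hσ1 (hQ.eq_one_of_fixes h0 h1 hj hb)
    generalize φ = g at *
    fin_cases j <;> simp only [Fin.reduceFinMk, Fin.zero_eta, Fin.mk_one, v2, v3, v4] at hb ⊢
    · simp
    · simp
    all_goals exfalso; linarith
  · rintro _ (rfl | rfl)
    · exact ⟨⟨0, rfl⟩, 0, h0⟩
    · exact ⟨⟨1, rfl⟩, 1, h1⟩

end IsRegularRightPentagon

/-! ### Pentagons of Cayley graphs -/

/-- The vertex sets of the pentagons (cycles of length five) of a graph. -/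
def pentagons {V : Type*} (Γ : SimpleGraph V) : Set (Set V) :=
  {F | ∃ x : Fin 5 → V, Function.Injective x ∧ (∀ i, Γ.Adj (x i) (x (i + 1))) ∧ Set.range x = F}

theorem image_mem_pentagons {V W : Type*} {Γ : SimpleGraph V} {Δ : SimpleGraph W} (f : Γ ≃g Δ)
    {F : Set V} (hF : F ∈ pentagons Γ) : f '' F ∈ pentagons Δ := by
  obtain ⟨x, hinj, hx, rfl⟩ := hF
  exact ⟨f ∘ x, f.injective.comp hinj, fun i => f.map_adj_iff.2 (hx i), Set.range_comp f x⟩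

theorem ncard_of_mem_pentagons {V : Type*} {Γ : SimpleGraph V} {F : Set V}
    (hF : F ∈ pentagons Γ) : F.ncard = 5 := by
  obtain ⟨x, hinj, -, rfl⟩ := hF
  rw [← Set.image_univ, Set.ncard_image_of_injective _ hinj]
  simp

open Pointwise in
/-- If two pentagons of a Cayley graph meet in exactly two vertices, then five or more pentagons pass
through some vertex: the pentagons form a left-invariant family of subsets of the group. -/
theorem not_isCayleyGraph_of_pentagons {V : Type*} {Γ : SimpleGraph V} {E F : Set V}
    (hE : E ∈ pentagons Γ) (hF : F ∈ pentagons Γ) {v w : V} (hvw : v ≠ w) (hEF : E ∩ F = {v, w})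
    (hcard : ∀ u, {F ∈ pentagons Γ | u ∈ F}.encard < 5) (G : Type*) [Group G] :
    ¬ IsCayleyGraph Γ G := by
  rintro ⟨S, -, -, ⟨f⟩⟩
  refine inter_ne_pair_of_encard_lt (pentagons (SimpleGraph.mulCayley S)) Nat.prime_five
    (by decide) ?_ (fun _ => ncard_of_mem_pentagons) ?_ (image_mem_pentagons f.symm hE)
    (image_mem_pentagons f.symm hF) (f.symm.injective.ne hvw) ?_
  · rintro g _ ⟨x, hinj, hx, rfl⟩
    refine ⟨fun i => g * x i, (mul_right_injective g).comp hinj,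
      fun i => SimpleGraph.mulCayley_adj_mul_iff_right.2 (hx i), ?_⟩
    exact Set.range_comp (g * ·) x
  · rw [← f.injective.image_injective.encard_image]
    refine (Set.encard_le_encard ?_).trans_lt (hcard (f 1))
    rintro _ ⟨F, ⟨hF, h1⟩, rfl⟩
    exact ⟨image_mem_pentagons f hF, 1, h1, rfl⟩
  · rw [← Set.image_inter f.symm.injective, hEF, Set.image_pair]

/-! ### Neighbours and pentagons in the graph of the tessellation -/

variable {P : Fin 5 → ℍ}

theorem cosh_dist_of_adj (hP : IsRegularRightPentagon P) {v w : gridVertices P}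
    (h : (gridGraph P).Adj v w) : Real.cosh (dist (v : ℍ) w) = φ := by
  obtain ⟨-, Q, hQ, i, ⟨hv, hw⟩ | ⟨hw, hv⟩⟩ := h <;> rw [hv, hw]
  · exact (hQ.isRegularRightPentagon hP).cosh_side i
  · rw [dist_comm]
    exact (hQ.isRegularRightPentagon hP).cosh_side i

theorem IsTile.range_mem_pentagons (hP : IsRegularRightPentagon P) {Q : Fin 5 → ℍ}
    (hQ : IsTile P Q) : (↑) ⁻¹' Set.range Q ∈ pentagons (gridGraph P) := by
  have hinj := (hQ.isRegularRightPentagon hP).injective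
  refine ⟨fun i => ⟨Q i, Q, hQ, i, rfl⟩, fun i j h => hinj (congrArg Subtype.val h), fun i => ?_, ?_⟩
  · exact ⟨fun h => by simpa using hinj (congrArg Subtype.val h), Q, hQ, i, .inl ⟨rfl, rfl⟩⟩
  · ext v
    exact exists_congr fun i => Subtype.ext_iff

/-- A vertex of the tessellation belongs to at most four pentagons of its graph. -/
theorem encard_pentagons_lt (hP : IsRegularRightPentagon P) (v : gridVertices P) :
    {F ∈ pentagons (gridGraph P) | v ∈ F}.encard < 5 := by
  obtain ⟨Q, hQ, hQ0, hQP⟩ := exists_pentagon_at_vertex hP v.2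
  let c : gridVertices P → ℝ × ℝ × ℝ := fun z => frameCoord Q z
  have hc : Function.Injective c := hQ.frameCoord_injective.comp Subtype.val_injective
  rw [← hc.image_injective.encard_image]
  let D : Set (Set (ℝ × ℝ × ℝ)) :=
    {Set.range (pentagonCoord 1 1), Set.range (pentagonCoord 1 (-1)),
      Set.range (pentagonCoord (-1) 1), Set.range (pentagonCoord (-1) (-1))}
  have hD : D.encard < 5 := by
    have h4 : D.encard ≤ 4 := by
      refine (Set.encard_insert_le _ _).trans ?_
      refine (add_le_add_left ((Set.encard_insert_le _ _).trans
        (add_le_add_left ((Set.encard_insert_le _ _).trans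
          (add_le_add_left (Set.encard_singleton _).le 1)) 1)) 1).trans ?_
      norm_num
    exact h4.trans_lt (by norm_num)
  refine (Set.encard_le_encard ?_).trans_lt hD
  rintro _ ⟨_, ⟨⟨x, hinj, hx, rfl⟩, k, hk⟩, rfl⟩
  have hk' : (x k : ℍ) = Q 0 := by rw [hk, hQ0]
  obtain ⟨ε, hε, δ, hδ, h⟩ := hQ.exists_range_eq_pentagonCoord
    (x := fun i => (x (i + k) : ℍ)) (fun i => hQ.isGoldenPoint_of_mem (hQP.symm.subset (x (i + k)).2))
    (Subtype.val_injective.comp (hinj.comp (add_left_injective k))) (by simpa using hk')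
    (fun i => by
      have := cosh_dist_of_adj hP (hx (i + k))
      rwa [add_right_comm] at this)
  have e : c '' Set.range x = Set.range (pentagonCoord ε δ) := by
    rw [← h, ← Set.range_comp, ← (Equiv.addRight k).surjective.range_comp (c ∘ x)]
    rfl
  rw [e]
  rcases hε with rfl | rfl <;> rcases hδ with rfl | rfl <;> simp [D]

/-- An isometry preserving the vertices of the tessellation cannot move every vertex to a neighbour.
If it did, then, as there are no quadrilaterals, it would map one end of each edge to the other; but
of three edges at a vertex `v`, it can map `v` to the other end of at most one, and the other end of
at most one to `v`. -/
theorem exists_cosh_dist_ne (hP : IsRegularRightPentagon P) {γ : ℍ ≃ᵢ ℍ}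
    (hγ : ∀ v ∈ gridVertices P, γ v ∈ gridVertices P) :
    ∃ v ∈ gridVertices P, Real.cosh (dist v (γ v)) ≠ φ := by
  by_contra! hmove
  have hmem : ∀ i, P i ∈ gridVertices P := fun i => ⟨P, .base, i, rfl⟩
  have key : ∀ u ∈ gridVertices P, Real.cosh (dist u (P 0)) = φ → γ u = P 0 ∨ γ (P 0) = u := by
    intro u hu huv
    by_contra! hne
    refine hne.1 (hP.eq_of_common_neighbors (x := u) (y := γ (P 0)) (z := γ u)
      (hP.isGoldenPoint_of_mem hu) (hP.isGoldenPoint_of_mem (hγ _ (hmem 0)))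
      (hP.isGoldenPoint_of_mem (hγ _ hu)) huv ?_ ?_ ?_ hne.2.symm)
    · rw [dist_comm, hmove _ (hmem 0)]
    · rw [dist_comm, hmove _ hu]
    · rw [γ.dist_eq, huv]
  -- A third neighbour of `P 0`, besides `P 1` and `P 4`.
  obtain ⟨σ, hσ⟩ := exists_isReflectionInLine (P 0) (P 1)
  have h4 := hP.frameCoord_vertex.2.2.2.2
  have hne4 : σ (P 4) ≠ P 4 := fun h => hσ.1 (hP.eq_one_of_fixes hσ.2.1 hσ.2.2 h (by simp [h4]))
  have hne1 : σ (P 4) ≠ P 1 := fun h => by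
    have := hP.injective (σ.injective (h.trans hσ.2.2.symm))
    simp at this
  have hne14 : P 1 ≠ P 4 := fun h => by simpa using hP.injective h
  have s1 : Real.cosh (dist (P 1) (P 0)) = φ := by rw [dist_comm]; exact hP.cosh_side 0
  have s4 : Real.cosh (dist (P 4) (P 0)) = φ := hP.cosh_side 4
  have s4' : Real.cosh (dist (σ (P 4)) (P 0)) = φ := by
    rw [← s4, ← σ.dist_eq (P 4), hσ.2.1]
  have k1 := key _ (hmem 1) s1
  have k4 := key _ (hmem 4) s4
  have k4' := key (σ (P 4)) ⟨_, .reflect P P 0 σ .base .base hσ, 4, rfl⟩ s4'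
  rcases k1 with k1 | k1 <;> rcases k4 with k4 | k4 <;> rcases k4' with k4' | k4'
  · exact hne14 (γ.injective (k1.trans k4.symm))
  · exact hne14 (γ.injective (k1.trans k4.symm))
  · exact hne1 (γ.injective (k4'.trans k1.symm))
  · exact hne4 (k4'.symm.trans k4)
  · exact hne4 (γ.injective (k4'.trans k4.symm))
  · exact hne1 (k4'.symm.trans k1)
  · exact hne14 (k1.symm.trans k4)
  · exact hne14 (k1.symm.trans k4)

theorem map_mem_gridVertices {G : Subgroup (ℍ ≃ᵢ ℍ)} (hG : LeavesGridInvariant P G)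
    {γ : ℍ ≃ᵢ ℍ} (hγ : γ ∈ G) {v : ℍ} (hv : v ∈ gridVertices P) : γ v ∈ gridVertices P := by
  obtain ⟨Q, hQ, hv⟩ := hv
  obtain ⟨R, hR, h⟩ := hG γ hγ Q hQ
  exact ⟨R, hR, h ▸ ⟨v, hv, rfl⟩⟩

theorem not_isGeometricCayleyGraph (hP : IsRegularRightPentagon P) {G : Subgroup (ℍ ≃ᵢ ℍ)}
    (hG : LeavesGridInvariant P G) {A : gridVertices P → gridVertices P → Prop}
    (hA : IsDirectedVersion (gridGraph P) A) : ¬ IsGeometricCayleyGraph A G := by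
  rintro ⟨S, -, hS, harc, -, hlab⟩
  let v : Fin 5 → gridVertices P := fun i => ⟨P i, P, .base, i, rfl⟩
  obtain ⟨u, γ, hγ⟩ : ∃ u, ∃ γ, γ ∈ labelsAround A (S ∪ S⁻¹) u := by
    have hadj : (gridGraph P).Adj (v 0) (v 1) :=
      ⟨fun h => by simpa using hP.injective (congrArg Subtype.val h), P, .base, 0, .inl ⟨rfl, rfl⟩⟩
    rcases (hA _ _).2 hadj with h | h
    · obtain ⟨γ, hγ, e⟩ := harc _ _ h
      exact ⟨v 0, γ, hγ, v 1, .inl ⟨h, e⟩⟩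
    · obtain ⟨γ, hγ, e⟩ := harc _ _ h
      exact ⟨v 1, γ, hγ, v 0, .inl ⟨h, e⟩⟩
  have hγG : γ ∈ G := by
    rw [← hS]
    rcases hγ.1 with h | h
    · exact Subgroup.subset_closure h
    · exact inv_mem_iff.1 (Subgroup.subset_closure h)
  obtain ⟨x, hx, hne⟩ := exists_cosh_dist_ne hP fun z hz => map_mem_gridVertices hG hγG hz
  -- The label `γ` occurs around every vertex, hence moves every vertex to a neighbour.
  rw [hlab u ⟨x, hx⟩] at hγ
  obtain ⟨-, w, ⟨h, e⟩ | ⟨h, e⟩⟩ := hγ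
  all_goals have hd : Real.cosh (dist _ _) = φ := cosh_dist_of_adj hP ((hA _ _).1 (.inl h))
  · exact hne ((congrArg (fun y => Real.cosh (dist x y)) e).trans hd)
  · rw [← γ.dist_eq] at hd
    exact hne ((congrArg (fun y => Real.cosh (dist y (γ x))) e).symm.trans hd)

theorem mainTheorem3 (P : Fin 5 → ℍ) (hP : IsRegularRightPentagon P)
    (G : Subgroup (ℍ ≃ᵢ ℍ)) (hG : LeavesGridInvariant P G) :
    (∀ A : gridVertices P → gridVertices P → Prop, IsDirectedVersion (gridGraph P) A →
      ¬ IsGeometricCayleyGraph A G) ∧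
    ¬ IsCayleyGraph (gridGraph P) G := by
  refine ⟨fun A hA => not_isGeometricCayleyGraph hP hG hA, ?_⟩
  obtain ⟨σ, hσ⟩ := exists_isReflectionInLine (P 0) (P 1)
  refine not_isCayleyGraph_of_pentagons (IsTile.range_mem_pentagons hP .base)
    (IsTile.range_mem_pentagons hP (.reflect P P 0 σ .base .base hσ))
    (v := ⟨P 0, P, .base, 0, rfl⟩) (w := ⟨P 1, P, .base, 1, rfl⟩)
    (fun h => by simpa using hP.injective (congrArg Subtype.val h)) ?_ (encard_pentagons_lt hP) G
  rw [← Set.preimage_inter, hP.range_inter_range_reflection hσ]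
  ext v
  simp [Subtype.ext_iff]

end
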